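/- Let $m\ge 2$ and let $\mathcal Y$ be a set of $m$ classes. For a probability distribution $p$ on $\mathcal Y$ with a unique most probable class, let $y_1,\dots,y_m$ be the classes listed by decreasing probability under $p$ (so that $y_1$ is the mode of $p$), and set $$\Delta_2^2 := \Delta_2^2(p) := -\ln\Bigl(1-\bigl(\sqrt{p(y_1)}-\sqrt{p(y_2)}\bigr)^2\Bigr)\in(0,+\infty].$$ **Corollary (minimax lower bound).** For any distribution $p_0$ on $\mathcal Y$ with a unique mode there is a constant $c\in\mathbb R$, depending only on $p_0$, with the following property. For every $n\ge 0$ and every (possibly randomized) estimator $\hat y=\mathcal A(Y_1,\dots,Y_n)\in\mathcal Y$ based on $n$ samples, there exists a permutation $\sigma$ of $\mathcal Y$ such that, when $Y_1,\dots,Y_n$ are independent with law $p$ given by $p(y)=p_0(\sigma(y))$, and $y_1$ and $\Delta_2$ are those of $p$, $$\mathbb P(\hat y\neq y_1)\;\ge\;\exp\bigl(-n\Delta_2^2-m\ln(n+1)-c\bigr).$$ (The right-hand side uses the conventions $\exp(-\infty)=0$ and $0\cdot(+\infty)=0$.) -/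

import Mathlib

open MeasureTheory ProbabilityTheory

/-- The distribution `y ↦ p₀ (σ y)`, i.e. the push-forward of `p₀` under `σ⁻¹`. -/
noncomputable def permutedPMF {𝒴 : Type*} (p₀ : PMF 𝒴) (σ : Equiv.Perm 𝒴) : PMF 𝒴 :=
  p₀.map σ.symm

theorem permutedPMF_apply {𝒴 : Type*} (p₀ : PMF 𝒴) (σ : Equiv.Perm 𝒴) (y : 𝒴) :
    permutedPMF p₀ σ y = p₀ (σ y) := by
  classical
  rw [permutedPMF, PMF.map_apply, tsum_eq_single (σ y)]
  · simp
  · intro z hz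
    rw [if_neg]
    rintro rfl
    simp at hz

/-- `p` has exactly one most probable class. -/
def HasUniqueMode {𝒴 : Type*} (p : PMF 𝒴) : Prop :=
  ∃! y₁ : 𝒴, ∀ y : 𝒴, p y ≤ p y₁

/-- `y 0, y 1, …` lists all the classes, by decreasing probability under `p`. -/
def IsDecreasingEnumeration {𝒴 : Type*} (p : PMF 𝒴) {m : ℕ} (y : Fin m ≃ 𝒴) : Prop :=
  Antitone fun i => p (y i)

theorem exists_isDecreasingEnumeration {𝒴 : Type*} [Fintype 𝒴] (p : PMF 𝒴) :
    ∃ y : Fin (Fintype.card 𝒴) ≃ 𝒴, IsDecreasingEnumeration p y := by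
  let e := (Fintype.equivFin 𝒴).symm
  let f : Fin (Fintype.card 𝒴) → (ENNReal)ᵒᵈ := fun i => OrderDual.toDual (p (e i))
  refine ⟨(Tuple.sort f).trans e, fun i j hij => ?_⟩
  exact Tuple.monotone_sort f hij

/-- `Δ² = - ln (1 - (√p(y₁) - √p(y))²)`, as an extended real number: it is `⊤` when
`p(y₁) = 1` and `p(y) = 0`. -/
noncomputable def deltaSq {𝒴 : Type*} (p : PMF 𝒴) (y₁ y : 𝒴) : EReal :=
  -ENNReal.log (ENNReal.ofReal (1 - (√(p y₁).toReal - √(p y).toReal) ^ 2))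

/-- The law of the prediction `ŷ = 𝒜(Y₁, …, Yₙ)` of a (possibly randomized) estimator `𝒜`, when
`Y₁, …, Yₙ` are independent with law `p`. A deterministic estimator is a deterministic kernel. -/
noncomputable def predictionLaw {𝒴 : Type*} [MeasurableSpace 𝒴] (p : PMF 𝒴) {n : ℕ}
    (𝒜 : Kernel (Fin n → 𝒴) 𝒴) : Measure 𝒴 :=
  (Measure.pi fun _ : Fin n => p.toMeasure).bind 𝒜

/-- The probability of error `ℙ(ŷ ≠ y₁)`. -/
noncomputable def errorProb {𝒴 : Type*} [MeasurableSpace 𝒴] (p : PMF 𝒴) {n : ℕ}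
    (𝒜 : Kernel (Fin n → 𝒴) 𝒴) (y₁ : 𝒴) : ENNReal :=
  predictionLaw p 𝒜 {y | y ≠ y₁}

/-! Le Cam's two-point method, applied to `p₀` and its image under the swap of its two top classes
`u`, `v`, whose modes are `u` and `v`: the two errors sum to at least the overlap of the product
laws (`sum_min_le_errorProb_add`). With `f` the mass function and `g` the geometric mean of `f` and
its swap, `f = g * exp (t * d)` where `d` is `1` at `u`, `-1` at `v` and `0` elsewhere; swapping
negates `d`. The total mass of `g` is `exp (-Δ₂²)` (`sum_sqrt_mul_swap`). When the walk with steps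
`d` ends within `1` of the origin, both likelihoods are at least `exp (-t)` times the product of the
`g`'s. By symmetry and Cauchy–Schwarz such samples carry at least a fraction `1 / (n + 1)` of the
`g`-mass (`pow_le_sum_near_return`). -/

section LatticeWalk

variable {α : Type*} [Fintype α]

/-- The squared mass of the fibers of a walk with steps in `{-1, 0, 1}` is at least the squared
total mass over the number of possible endpoints. -/
theorem sq_le_sum_fiber_mul (g : α → ℝ) (d : α → ℤ) (hd : ∀ y, |d y| ≤ 1) (k : ℕ) :
    (∑ y, g y) ^ (k + k) ≤ ((k + k : ℕ) + 1 : ℝ) *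
      ∑ x : Fin k → α, (∏ i, g (x i)) *
        ∑ z : Fin k → α with ∑ i, d (z i) = ∑ i, d (x i), ∏ i, g (z i) := by
  classical
  set G : (Fin k → α) → ℝ := fun x => ∏ i, g (x i)
  set D : (Fin k → α) → ℤ := fun x => ∑ i, d (x i)
  have hD : ∀ x ∈ (Finset.univ : Finset (Fin k → α)), D x ∈ Finset.Icc (-(k : ℤ)) k := by
    intro x _
    have h : |D x| ≤ k := by
      refine (Finset.abs_sum_le_sum_abs _ _).trans ?_
      refine (Finset.sum_le_card_nsmul _ _ 1 fun i _ => hd (x i)).trans ?_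
      simp
    exact Finset.mem_Icc.2 (abs_le.1 h)
  -- Cauchy–Schwarz over the `2k + 1` possible endpoints.
  have hcs := sq_sum_le_card_mul_sum_sq (s := Finset.Icc (-(k : ℤ)) k)
    (f := fun t => ∑ z with D z = t, G z)
  rw [Finset.sum_fiberwise_of_maps_to hD, ← Fintype.sum_pow, ← pow_mul, mul_two] at hcs
  refine hcs.trans_eq ?_
  congr 1
  · rw [Int.card_Icc]
    have : ((k : ℤ) + 1 - -(k : ℤ)).toNat = k + k + 1 := by omega
    rw [this]; push_cast; ring
  · rw [← Finset.sum_fiberwise_of_maps_to hD]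
    refine Finset.sum_congr rfl fun t _ => ?_
    rw [sq, Finset.sum_mul]
    refine Finset.sum_congr rfl fun x hx => ?_
    rw [← (Finset.mem_filter.1 hx).2]

/-- A walk of even length with symmetric steps in `{-1, 0, 1}` returns to the origin with
probability at least one over the number of possible endpoints. -/
theorem pow_le_sum_return_even (g : α → ℝ) (d : α → ℤ) (hd : ∀ y, |d y| ≤ 1) (s : Equiv.Perm α)
    (hgs : ∀ y, g (s y) = g y) (hds : ∀ y, d (s y) = -d y) (k : ℕ) :
    (∑ y, g y) ^ (k + k) ≤ ((k + k : ℕ) + 1 : ℝ) *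
      ∑ x : Fin (k + k) → α with ∑ i, d (x i) = 0, ∏ i, g (x i) := by
  classical
  refine (sq_le_sum_fiber_mul g d hd k).trans_eq ?_
  congr 1
  rw [Finset.sum_filter, ← (Fin.appendEquiv k k).sum_comp, Fintype.sum_prod_type]
  refine Finset.sum_congr rfl fun x _ => ?_
  -- Applying `s` to the second half negates its displacement, so two halves with equal endpoints
  -- form a closed walk.
  rw [Finset.mul_sum, Finset.sum_filter, ← (Equiv.piCongrRight fun _ : Fin k => s).sum_comp]
  refine Finset.sum_congr rfl fun z _ => ?_
  simp only [Fin.appendEquiv, Equiv.coe_fn_mk, Fin.prod_univ_add, Fin.sum_univ_add,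
    Fin.append_left, Fin.append_right, Equiv.piCongrRight_apply, Pi.map_apply, hgs, hds,
    Finset.sum_neg_distrib]
  exact if_congr (by constructor <;> intro h <;> linarith) rfl rfl

/-- A walk with symmetric steps in `{-1, 0, 1}` ends at distance at most `1` from the origin with
probability at least `1 / (n + 1)`. -/
theorem pow_le_sum_near_return (g : α → ℝ) (hg : ∀ y, 0 ≤ g y) (d : α → ℤ) (hd : ∀ y, |d y| ≤ 1)
    (s : Equiv.Perm α) (hgs : ∀ y, g (s y) = g y) (hds : ∀ y, d (s y) = -d y) (n : ℕ) :
    (∑ y, g y) ^ n ≤ (n + 1 : ℝ) *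
      ∑ x : Fin n → α with |∑ i, d (x i)| ≤ 1, ∏ i, g (x i) := by
  classical
  have hG : ∀ {j : ℕ} (x : Fin j → α), 0 ≤ ∏ i, g (x i) :=
    fun x => Finset.prod_nonneg fun i _ => hg _
  rcases Nat.even_or_odd' n with ⟨k, rfl | rfl⟩
  · rw [two_mul]
    refine (pow_le_sum_return_even g d hd s hgs hds k).trans ?_
    refine mul_le_mul_of_nonneg_left ?_ (by positivity)
    refine Finset.sum_le_sum_of_subset_of_nonneg (fun x hx => ?_) fun x _ _ => hG x
    simp only [Finset.mem_filter_univ] at hx ⊢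
    simp [hx]
  · rw [two_mul, pow_succ']
    have hS : 0 ≤ ∑ y, g y := Finset.sum_nonneg fun y _ => hg y
    refine (mul_le_mul_of_nonneg_left (pow_le_sum_return_even g d hd s hgs hds k) hS).trans ?_
    rw [mul_left_comm]
    refine mul_le_mul (by push_cast; linarith) ?_
      (mul_nonneg hS (Finset.sum_nonneg fun x _ => hG x)) (by positivity)
    rw [Finset.sum_filter, Finset.sum_filter,
      ← (Fin.consEquiv fun _ : Fin (k + k + 1) => α).sum_comp, Fintype.sum_prod_type,
      Finset.sum_mul]
    refine Finset.sum_le_sum fun y _ => ?_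
    rw [Finset.mul_sum]
    refine Finset.sum_le_sum fun x _ => ?_
    simp only [Fin.consEquiv, Equiv.coe_fn_mk, Fin.prod_univ_succ, Fin.sum_univ_succ,
      Fin.cons_zero, Fin.cons_succ]
    -- For odd length, only walks that close up after their first step are kept.
    by_cases hx : ∑ i, d (x i) = 0
    · simp [hx, hd y]
    · rw [if_neg hx, mul_zero]
      split_ifs
      · exact mul_nonneg (hg y) (hG x)
      · exact le_rfl

end LatticeWalk

/-! ### Overlap of the two product laws -/

section Overlap

variable {α : Type*} [Fintype α] [DecidableEq α]

/-- The Bhattacharyya coefficient of a distribution and of its image under a transposition. -/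
theorem sum_sqrt_mul_swap (f : α → ℝ) (hf : ∀ y, 0 ≤ f y) (hsum : ∑ y, f y = 1) {u v : α}
    (huv : u ≠ v) :
    ∑ y, √(f y * f (Equiv.swap u v y)) = 1 - (√(f u) - √(f v)) ^ 2 := by
  have hv : v ∈ Finset.univ.erase u := Finset.mem_erase.2 ⟨huv.symm, Finset.mem_univ v⟩
  have h1 : ∀ h : α → ℝ, ∑ y, h y = h u + (h v + ∑ y ∈ (Finset.univ.erase u).erase v, h y) :=
    fun h => by rw [Finset.add_sum_erase _ h hv, Finset.add_sum_erase _ h (Finset.mem_univ u)]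
  have h2 : ∑ y ∈ (Finset.univ.erase u).erase v, √(f y * f (Equiv.swap u v y))
      = ∑ y ∈ (Finset.univ.erase u).erase v, f y := by
    refine Finset.sum_congr rfl fun y hy => ?_
    simp only [Finset.mem_erase] at hy
    rw [Equiv.swap_apply_of_ne_of_ne hy.2.1 hy.1, Real.sqrt_mul_self (hf y)]
  rw [h1] at hsum ⊢
  rw [h2, Equiv.swap_apply_left, Equiv.swap_apply_right, Real.sqrt_mul (hf u), Real.sqrt_mul (hf v)]
  nlinarith [Real.sq_sqrt (hf u), Real.sq_sqrt (hf v)]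

theorem exists_overlap_ge_of_pos (f : α → ℝ) (hf : ∀ y, 0 ≤ f y) (hsum : ∑ y, f y = 1) {u v : α}
    (huv : u ≠ v) (hv : 0 < f v) (hvu : f v ≤ f u) :
    ∃ κ : ℝ, 0 < κ ∧ ∀ n : ℕ,
      κ * (1 - (√(f u) - √(f v)) ^ 2) ^ n ≤ (n + 1 : ℝ) *
        ∑ x : Fin n → α, min (∏ i, f (x i)) (∏ i, f (Equiv.swap u v (x i))) := by
  set g : α → ℝ := fun y => √(f y * f (Equiv.swap u v y)) with hg
  set d : α → ℤ := fun y => if y = u then 1 else if y = v then -1 else 0 with hd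
  -- The tilt for which `f = g * exp (t * d)`, since `exp t = √(f u / f v)`.
  set t : ℝ := Real.log (f u / f v) * (1 / 2) with ht
  have hu : 0 < f u := hv.trans_le hvu
  have ht0 : 0 ≤ t := mul_nonneg (Real.log_nonneg ((one_le_div hv).2 hvu)) (by norm_num)
  have hexp : Real.exp t = √(f u / f v) := by
    rw [Real.sqrt_eq_rpow, Real.rpow_def_of_pos (div_pos hu hv)]
  have hexp' : Real.exp (-t) = √(f v / f u) := by
    rw [Real.exp_neg, hexp, ← Real.sqrt_inv, inv_div]
  have hgs : ∀ y, g (Equiv.swap u v y) = g y := fun y => by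
    simp only [hg, Equiv.swap_apply_self]; rw [mul_comm]
  have hds : ∀ y, d (Equiv.swap u v y) = -d y := fun y => by
    by_cases h1 : y = u
    · subst h1; simp [hd, huv.symm]
    by_cases h2 : y = v
    · subst h2; simp [hd, h1]
    rw [Equiv.swap_apply_of_ne_of_ne h1 h2]
    simp [hd, h1, h2]
  have hd1 : ∀ y, |d y| ≤ 1 := fun y => by
    simp only [hd]; split_ifs <;> simp
  have hfg : ∀ y, f y = g y * Real.exp (t * d y) := fun y => by
    by_cases h1 : y = u
    · subst h1
      simp only [hg, hd, Equiv.swap_apply_left, if_true, Int.cast_one, mul_one, hexp]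
      rw [← Real.sqrt_mul (by positivity),
        show f y * f v * (f y / f v) = f y * f y by field_simp, Real.sqrt_mul_self hu.le]
    by_cases h2 : y = v
    · subst h2
      simp only [hg, hd, Equiv.swap_apply_right, if_true, if_neg h1, Int.cast_neg, Int.cast_one,
        mul_neg, mul_one, hexp']
      rw [← Real.sqrt_mul (by positivity),
        show f y * f u * (f y / f u) = f y * f y by field_simp, Real.sqrt_mul_self hv.le]
    simp [hg, hd, h1, h2, Equiv.swap_apply_of_ne_of_ne h1 h2, Real.sqrt_mul_self (hf y)]
  have hprod : ∀ {n : ℕ} (x : Fin n → α),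
      ∏ i, f (x i) = (∏ i, g (x i)) * Real.exp (t * (∑ i, d (x i) : ℤ)) := fun x => by
    rw [Int.cast_sum, Finset.mul_sum, Real.exp_sum, ← Finset.prod_mul_distrib]
    exact Finset.prod_congr rfl fun i _ => hfg _
  have hprod' : ∀ {n : ℕ} (x : Fin n → α), ∏ i, f (Equiv.swap u v (x i))
      = (∏ i, g (x i)) * Real.exp (-(t * (∑ i, d (x i) : ℤ))) := fun x => by
    rw [hprod fun i => Equiv.swap u v (x i)]
    simp only [hgs, hds, Finset.sum_neg_distrib, Int.cast_neg, mul_neg]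
  have hG : ∀ {n : ℕ} (x : Fin n → α), 0 ≤ ∏ i, g (x i) :=
    fun x => Finset.prod_nonneg fun i _ => Real.sqrt_nonneg _
  refine ⟨Real.exp (-t), Real.exp_pos _, fun n => ?_⟩
  rw [← sum_sqrt_mul_swap f hf hsum huv]
  refine (mul_le_mul_of_nonneg_left (pow_le_sum_near_return g (fun y => Real.sqrt_nonneg _) d hd1
    (Equiv.swap u v) hgs hds n) (Real.exp_pos _).le).trans ?_
  rw [mul_left_comm]
  refine mul_le_mul_of_nonneg_left ?_ (by positivity)
  rw [Finset.sum_filter, Finset.mul_sum]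
  refine Finset.sum_le_sum fun x _ => ?_
  split_ifs with hx
  · have hx' := abs_le.1 hx
    have h1 : (-1 : ℝ) ≤ (∑ i, d (x i) : ℤ) := by exact_mod_cast hx'.1
    have h2 : ((∑ i, d (x i) : ℤ) : ℝ) ≤ 1 := by exact_mod_cast hx'.2
    rw [mul_comm, hprod, hprod', ← mul_min_of_nonneg _ _ (hG x)]
    refine mul_le_mul_of_nonneg_left (le_min ?_ ?_) (hG x) <;> refine Real.exp_le_exp.2 ?_ <;>
      nlinarith
  · rw [mul_zero]
    exact le_min (Finset.prod_nonneg fun i _ => hf _) (Finset.prod_nonneg fun i _ => hf _)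

/-- The overlap of the `n`-fold powers of a distribution and of its image under the transposition
of its two most probable points is, up to a linear factor, at least the `n`-th power of their
Bhattacharyya coefficient. -/
theorem exists_overlap_ge (f : α → ℝ) (hf : ∀ y, 0 ≤ f y) (hsum : ∑ y, f y = 1) {u v : α}
    (huv : u ≠ v) (hvu : f v ≤ f u) (hle : ∀ y, y ≠ u → f y ≤ f v) :
    ∃ κ : ℝ, 0 < κ ∧ ∀ n : ℕ,
      κ * (1 - (√(f u) - √(f v)) ^ 2) ^ n ≤ (n + 1 : ℝ) *
        ∑ x : Fin n → α, min (∏ i, f (x i)) (∏ i, f (Equiv.swap u v (x i))) := by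
  rcases (hf v).lt_or_eq with hv | hv
  · exact exists_overlap_ge_of_pos f hf hsum huv hv hvu
  -- Here `f` is a point mass and the base of the power is `0`, so only `n = 0` has content.
  have hu : f u = 1 := by
    rw [← hsum, Finset.sum_eq_single u (fun y _ hy => ((hle y hy).trans_eq hv.symm).antisymm (hf y))
      (by simp)]
  refine ⟨1, one_pos, fun n => ?_⟩
  rw [hu, ← hv]
  rcases n with _ | n
  · simp
  · simp only [Real.sqrt_one, Real.sqrt_zero, sub_zero, one_pow, sub_self, ne_eq,
      Nat.add_eq_zero_iff, one_ne_zero, and_false, not_false_eq_true, zero_pow, mul_zero]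
    exact mul_nonneg (by positivity) (Finset.sum_nonneg fun x _ =>
      le_min (Finset.prod_nonneg fun i _ => hf _) (Finset.prod_nonneg fun i _ => hf _))

end Overlap

/-! ### Reduction to testing two laws -/

section TwoPoint

variable {𝒴 : Type*} [Fintype 𝒴] [MeasurableSpace 𝒴] [MeasurableSingletonClass 𝒴]

theorem errorProb_eq_sum (p : PMF 𝒴) {n : ℕ} (𝒜 : Kernel (Fin n → 𝒴) 𝒴) (y : 𝒴) :
    errorProb p 𝒜 y = ∑ x : Fin n → 𝒴, 𝒜 x {z | z ≠ y} * ∏ i, p (x i) := by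
  classical
  rw [errorProb, predictionLaw, Measure.bind_apply (Set.toFinite _).measurableSet
    𝒜.measurable.aemeasurable, lintegral_fintype]
  refine Finset.sum_congr rfl fun x _ => ?_
  rw [Measure.pi_singleton]
  simp only [PMF.toMeasure_apply_singleton _ _ (measurableSet_singleton _)]

/-- Le Cam's two-point bound. -/
theorem sum_min_le_errorProb_add (p q : PMF 𝒴) {n : ℕ} (𝒜 : Kernel (Fin n → 𝒴) 𝒴)
    [IsMarkovKernel 𝒜] {y z : 𝒴} (hyz : y ≠ z) :
    ∑ x : Fin n → 𝒴, min (∏ i, p (x i)) (∏ i, q (x i)) ≤ errorProb p 𝒜 y + errorProb q 𝒜 z := by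
  classical
  rw [errorProb_eq_sum, errorProb_eq_sum, ← Finset.sum_add_distrib]
  refine Finset.sum_le_sum fun x _ => ?_
  have h1 : 1 ≤ 𝒜 x {w | w ≠ y} + 𝒜 x {w | w ≠ z} := by
    rw [← measure_univ (μ := 𝒜 x)]
    refine (measure_mono fun w _ => ?_).trans (measure_union_le _ _)
    by_cases hw : w = y
    · exact Or.inr (hw ▸ hyz)
    · exact Or.inl hw
  calc min (∏ i, p (x i)) (∏ i, q (x i))
      ≤ (𝒜 x {w | w ≠ y} + 𝒜 x {w | w ≠ z}) * min (∏ i, p (x i)) (∏ i, q (x i)) :=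
        le_mul_of_one_le_left' h1
    _ ≤ _ := by
        rw [add_mul]
        gcongr
        · exact min_le_left _ _
        · exact min_le_right _ _

end TwoPoint

/-! ### Independence of the choice of enumeration -/

section Enumeration

variable {𝒴 : Type*}

theorem IsDecreasingEnumeration.apply_eq {p : PMF 𝒴} {m : ℕ} {e e' : Fin m ≃ 𝒴}
    (he : IsDecreasingEnumeration p e) (he' : IsDecreasingEnumeration p e') (i : Fin m) :
    p (e i) = p (e' i) := by
  have h := Tuple.unique_antitone (f := fun i => p (e i)) (σ := 1) (τ := e'.trans e.symm)
    he (by simpa [IsDecreasingEnumeration, Function.comp_def] using he')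
  simpa using congrFun h i

theorem IsDecreasingEnumeration.of_permutedPMF {p : PMF 𝒴} {m : ℕ} {σ : Equiv.Perm 𝒴}
    {y : Fin m ≃ 𝒴} (hy : IsDecreasingEnumeration (permutedPMF p σ) y) :
    IsDecreasingEnumeration p (y.trans σ) := by
  simpa [IsDecreasingEnumeration, permutedPMF_apply] using hy

theorem IsDecreasingEnumeration.apply_le_zero {p : PMF 𝒴} {m : ℕ} {e : Fin m ≃ 𝒴}
    (he : IsDecreasingEnumeration p e) (hm : 0 < m) (y : 𝒴) : p y ≤ p (e ⟨0, hm⟩) := by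
  simpa using he (Fin.mk_le_of_le_val (Nat.zero_le (e.symm y)) : (⟨0, hm⟩ : Fin m) ≤ e.symm y)

theorem IsDecreasingEnumeration.apply_le_one {p : PMF 𝒴} {m : ℕ} {e : Fin m ≃ 𝒴}
    (he : IsDecreasingEnumeration p e) (hm : 1 < m) {y : 𝒴} (hy : y ≠ e ⟨0, by omega⟩) :
    p y ≤ p (e ⟨1, hm⟩) := by
  have h : (⟨1, hm⟩ : Fin m) ≤ e.symm y := by
    rw [Fin.le_def]
    refine Nat.one_le_iff_ne_zero.2 fun h => hy ?_
    rw [← e.symm_apply_eq, Fin.ext_iff]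
    exact h
  simpa using he h

end Enumeration

/-- Covers infinite `Δ₂²` as well: for `r ≤ 0` the `EReal` convention `0 * ⊥ = 0` matches `0 ^ 0 =
1`. -/
theorem exp_neg_mul_neg_log_sub (r : ℝ) (n m : ℕ) {κ : ℝ} (hκ : 0 < κ) :
    EReal.exp (-(n : EReal) * -ENNReal.log (ENNReal.ofReal r)
        - ((m * Real.log (n + 1) : ℝ) : EReal) - ((Real.log (2 / κ) : ℝ) : EReal))
      = ENNReal.ofReal r ^ n * ENNReal.ofReal (κ / 2 / (n + 1 : ℝ) ^ m) := by
  rw [neg_mul_neg, sub_eq_add_neg, sub_eq_add_neg, EReal.exp_add, EReal.exp_add, EReal.exp_nmul,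
    ENNReal.exp_log, mul_assoc, ← EReal.coe_neg, ← EReal.coe_neg, EReal.exp_coe, EReal.exp_coe,
    ← ENNReal.ofReal_mul (Real.exp_pos _).le, Real.exp_neg, Real.exp_neg, Real.exp_log (by positivity),
    Real.exp_nat_mul, Real.exp_log (by positivity)]
  congr 2
  field_simp

theorem mainTheorem6 {𝒴 : Type*} [Fintype 𝒴] [MeasurableSpace 𝒴] [MeasurableSingletonClass 𝒴]
    (m : ℕ) (hm : 2 ≤ m) (hcard : Fintype.card 𝒴 = m) (p₀ : PMF 𝒴) (hp₀ : HasUniqueMode p₀) :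
    ∃ c : ℝ, ∀ (n : ℕ) (𝒜 : Kernel (Fin n → 𝒴) 𝒴) [IsMarkovKernel 𝒜],
      ∃ σ : Equiv.Perm 𝒴, ∀ y : Fin m ≃ 𝒴, IsDecreasingEnumeration (permutedPMF p₀ σ) y →
        EReal.exp (-(n : EReal) * deltaSq (permutedPMF p₀ σ) (y ⟨0, by omega⟩) (y ⟨1, by omega⟩)
            - ((m * Real.log (n + 1) : ℝ) : EReal) - (c : EReal))
          ≤ errorProb (permutedPMF p₀ σ) 𝒜 (y ⟨0, by omega⟩) := by
  classical
  obtain ⟨e, he⟩ : ∃ e : Fin m ≃ 𝒴, IsDecreasingEnumeration p₀ e :=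
    hcard ▸ exists_isDecreasingEnumeration p₀
  set u : 𝒴 := e ⟨0, by omega⟩ with hu
  set v : 𝒴 := e ⟨1, by omega⟩ with hv
  have huv : u ≠ v := by simp [hu, hv]
  set f : 𝒴 → ℝ := fun y => (p₀ y).toReal
  have hsum : ∑ y, f y = 1 := by
    rw [← ENNReal.toReal_sum fun y _ => p₀.apply_ne_top y, ← tsum_fintype (L := .unconditional 𝒴),
      p₀.tsum_coe, ENNReal.toReal_one]
  obtain ⟨κ, hκ, hmin⟩ := exists_overlap_ge f (fun y => ENNReal.toReal_nonneg) hsum huv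
    (ENNReal.toReal_mono (p₀.apply_ne_top _) (he.apply_le_zero (by omega) v))
    (fun y hy => ENNReal.toReal_mono (p₀.apply_ne_top _) (he.apply_le_one (by omega) hy))
  set r : ℝ := 1 - (√(f u) - √(f v)) ^ 2 with hr
  have hr0 : 0 ≤ r := by
    rw [hr, ← sum_sqrt_mul_swap f (fun y => ENNReal.toReal_nonneg) hsum huv]
    exact Finset.sum_nonneg fun y _ => Real.sqrt_nonneg _
  -- The `2` pays for splitting the overlap between two errors.
  refine ⟨Real.log (2 / κ), fun n 𝒜 _ => ?_⟩
  -- Ties may leave the second class undetermined, but not its probability, which is all that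
  -- `deltaSq` sees.
  have key : ∀ (σ : Equiv.Perm 𝒴) (y : Fin m ≃ 𝒴), IsDecreasingEnumeration (permutedPMF p₀ σ) y →
      σ (y ⟨0, by omega⟩) = u ∧
        deltaSq (permutedPMF p₀ σ) (y ⟨0, by omega⟩) (y ⟨1, by omega⟩)
          = -ENNReal.log (ENNReal.ofReal r) := by
    intro σ y hy
    have hσ := hy.of_permutedPMF
    refine ⟨hp₀.unique (hσ.apply_le_zero (by omega)) (he.apply_le_zero (by omega)), ?_⟩
    have h0 := hσ.apply_eq he ⟨0, by omega⟩
    have h1 := hσ.apply_eq he ⟨1, by omega⟩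
    simp only [Equiv.trans_apply] at h0 h1
    rw [deltaSq, permutedPMF_apply, permutedPMF_apply, h0, h1]
  set B : ENNReal := ENNReal.ofReal r ^ n * ENNReal.ofReal (κ / 2 / (n + 1 : ℝ) ^ m) with hB
  have hBB : B + B ≤ ∑ x : Fin n → 𝒴,
      min (∏ i, permutedPMF p₀ 1 (x i)) (∏ i, permutedPMF p₀ (Equiv.swap u v) (x i)) := by
    have hS : ∑ x : Fin n → 𝒴,
        min (∏ i, permutedPMF p₀ 1 (x i)) (∏ i, permutedPMF p₀ (Equiv.swap u v) (x i))
        = ENNReal.ofReal (∑ x : Fin n → 𝒴,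
            min (∏ i, f (x i)) (∏ i, f (Equiv.swap u v (x i)))) := by
      rw [ENNReal.ofReal_sum_of_nonneg fun x _ => le_min
        (Finset.prod_nonneg fun i _ => ENNReal.toReal_nonneg)
        (Finset.prod_nonneg fun i _ => ENNReal.toReal_nonneg)]
      refine Finset.sum_congr rfl fun x _ => ?_
      rw [ENNReal.ofReal_min, ENNReal.ofReal_prod_of_nonneg fun i _ => ENNReal.toReal_nonneg,
        ENNReal.ofReal_prod_of_nonneg fun i _ => ENNReal.toReal_nonneg]
      simp only [ENNReal.ofReal_toReal (p₀.apply_ne_top _), permutedPMF_apply, Equiv.Perm.coe_one, id_eq]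
    rw [hS, hB, ← ENNReal.ofReal_pow hr0, ← ENNReal.ofReal_mul (by positivity),
      ← ENNReal.ofReal_add (by positivity) (by positivity)]
    refine ENNReal.ofReal_le_ofReal ?_
    have hn : (0 : ℝ) < n + 1 := by positivity
    calc r ^ n * (κ / 2 / (n + 1 : ℝ) ^ m) + r ^ n * (κ / 2 / (n + 1 : ℝ) ^ m)
        = κ * r ^ n / (n + 1 : ℝ) ^ m := by ring
      -- The argument loses only one factor `n + 1`; the power `m` is slack.
      _ ≤ κ * r ^ n / (n + 1 : ℝ) :=
          div_le_div_of_nonneg_left (by positivity) hn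
            (le_self_pow₀ (by linarith [n.cast_nonneg (α := ℝ)]) (by omega))
      _ ≤ _ := (div_le_iff₀' hn).2 (hmin n)
  have hB2 : B ≤ errorProb (permutedPMF p₀ 1) 𝒜 u ∨
      B ≤ errorProb (permutedPMF p₀ (Equiv.swap u v)) 𝒜 v := by
    by_contra! h
    exact (hBB.trans (sum_min_le_errorProb_add _ _ 𝒜 huv)).not_gt (ENNReal.add_lt_add h.1 h.2)
  rcases hB2 with h | h
  · refine ⟨1, fun y hy => ?_⟩
    obtain ⟨h0, h1⟩ := key 1 y hy
    rw [h1, exp_neg_mul_neg_log_sub r n m hκ]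
    rwa [show y ⟨0, by omega⟩ = u from h0]
  · refine ⟨Equiv.swap u v, fun y hy => ?_⟩
    obtain ⟨h0, h1⟩ := key _ y hy
    rw [h1, exp_neg_mul_neg_log_sub r n m hκ]
    rwa [show y ⟨0, by omega⟩ = v from
      (Equiv.swap u v).injective (h0.trans (Equiv.swap_apply_right u v).symm)]
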